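/- Let $L\ge 1$ be an odd integer. Let $a_0,\dots,a_{L-1}$ be the annihilation operators of $L$ fermionic modes, acting on the Fock space $\mathcal H\cong(\mathbb C^2)^{\otimes L}$ with orthonormal Fock basis $|\boldsymbol n\rangle=(a_0^\dagger)^{n_0}\cdots(a_{L-1}^\dagger)^{n_{L-1}}|\boldsymbol 0\rangle$, $\boldsymbol n\in\{0,1\}^L$. Let $CU_{\rm Sym}(L)$ be the compact group of unitary $L\times L$ matrices $u$ with $u_{i,j}=u_{i+k,j+k}$ and $u_{i,j}=u_{j,i}$ for all $i,j,k$, indices being understood modulo $L$. For $u\in CU_{\rm Sym}(L)$ let $U=\exp\bigl(i\sum_{i,j}h_{i,j}a_i^\dagger a_j\bigr)$, $h$ Hermitian, be the corresponding free, particle number preserving evolution, i.e. the one with $Ua_iU^\dagger=\sum_j u_{i,j}a_j$ for all $i$. Consider the measurement channel $$\mathcal M(A)=\sum_{\boldsymbol n\in\{0,1\}^L}\mathbb E_{u}\,\langle\boldsymbol n|UAU^\dagger|\boldsymbol n\rangle\;U^\dagger|\boldsymbol n\rangle\langle\boldsymbol n|U ,$$ where $u$ is distributed according to the normalised Haar measure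 of $CU_{\rm Sym}(L)$, and let $W_2=\mathrm{span}_{\mathbb C}\{a_i^\dagger a_j: 0\le i,j\le L-1\}$ be the space of 2-point operators. Then $$\ker(\mathcal M|_{W_2})=\mathrm{span}_{\mathbb C}\Bigl\{\sum_{i=0}^{L-1}a_i^\dagger a_{i+k}\;:\;k=1,\dots,L-1\Bigr\},$$ with indices modulo $L$, and for $k\ne k'$ in $\{1,\dots,L-1\}$ the operators $\sum_i a_i^\dagger a_{i+k}$ and $\sum_i a_i^\dagger a_{i+k'}$ are orthogonal with respect to the Hilbert–Schmidt inner product $\langle A,B\rangle=\mathrm{Tr}(A^\dagger B)$ on operators on $\mathcal H$. -/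

import Mathlib

open scoped Matrix

noncomputable section

namespace FermionShadow

/-! ### Fock space, mode operators -/

/-- Occupation numbers `n : Fin L → Bool`, i.e. `n ∈ {0,1}^L`; they label the Fock basis `|n⟩`. -/
abbrev Occ (L : ℕ) : Type := Fin L → Bool

/-- Operators on the fermionic Hilbert space of `L` modes, as matrices `⟨m| A |n⟩` in the
orthonormal Fock basis. -/
abbrev FockOp (L : ℕ) : Type := Matrix (Occ L) (Occ L) ℂ

/-- The sign `(-1)^(n_0 + ⋯ + n_{j-1})`. -/
def jwSign {L : ℕ} (j : Fin L) (n : Occ L) : ℂ :=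
  (-1) ^ (Finset.univ.filter fun i : Fin L => i < j ∧ n i = true).card

/-- The annihilation operator `a_j`, for the Fock basis
`|n⟩ = (a_0†)^{n_0} ⋯ (a_{L-1}†)^{n_{L-1}} |0⟩`. The creation operator `a_j†` is its
conjugate transpose. -/
def ann {L : ℕ} (j : Fin L) : FockOp L :=
  Matrix.of fun m n =>
    if n j = true ∧ m = Function.update n j false then jwSign j n else 0

/-- The free, particle number preserving Hamiltonian `∑ h_{i,j} a_i† a_j`. -/
def freeHamiltonian {L : ℕ} (h : Matrix (Fin L) (Fin L) ℂ) : FockOp L :=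
  ∑ i, ∑ j, h i j • ((ann i)ᴴ * ann j)

/-- `U` is the evolution `exp(i H)` of a free, particle number preserving Hamiltonian, and `u` is
its action on the modes: `U a_i U† = ∑_j u_{i,j} a_j`. (The time `t` is absorbed in `h`.) -/
def IsFreeEvolution {L : ℕ} (U : FockOp L) (u : Matrix (Fin L) (Fin L) ℂ) : Prop :=
  (∃ h : Matrix (Fin L) (Fin L) ℂ, h.IsHermitian ∧
      U = NormedSpace.exp (Complex.I • freeHamiltonian h)) ∧
    ∀ i, U * ann i * Uᴴ = ∑ j, u i j • ann j

/-! ### Canonical anti-commutation relations -/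

lemma jwSign_eq_prod {L : ℕ} (j : Fin L) (n : Occ L) :
    jwSign j n = ∏ i : Fin L, if i < j ∧ n i = true then (-1 : ℂ) else 1 := by
  simp [jwSign, Finset.prod_ite]

lemma jwSign_mul_self {L : ℕ} (j : Fin L) (n : Occ L) : jwSign j n * jwSign j n = 1 := by
  unfold jwSign
  rw [← mul_pow]
  simp

lemma star_jwSign {L : ℕ} (j : Fin L) (n : Occ L) : star (jwSign j n) = jwSign j n := by
  simp [jwSign]

lemma jwSign_update_of_le {L : ℕ} {i j : Fin L} (hij : i ≤ j) (n : Occ L) (b : Bool) :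
    jwSign i (Function.update n j b) = jwSign i n := by
  rw [jwSign_eq_prod, jwSign_eq_prod]
  refine Finset.prod_congr rfl fun k _ => ?_
  by_cases hk : k = j
  · subst hk
    simp [not_lt.mpr hij]
  · simp [hk]

lemma jwSign_update_of_lt {L : ℕ} {i j : Fin L} (hij : j < i) (n : Occ L) (b : Bool)
    (hb : b = !n j) : jwSign i (Function.update n j b) = - jwSign i n := by
  rw [jwSign_eq_prod, jwSign_eq_prod, ← Finset.mul_prod_erase _ _ (Finset.mem_univ j),
    ← Finset.mul_prod_erase (a := j) _ (fun k => if k < i ∧ n k = true then (-1 : ℂ) else 1)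
      (Finset.mem_univ j)]
  have : ∀ k ∈ Finset.univ.erase j,
      (if k < i ∧ Function.update n j b k = true then (-1 : ℂ) else 1) =
        if k < i ∧ n k = true then (-1 : ℂ) else 1 := by
    intro k hk
    simp [Finset.ne_of_mem_erase hk]
  rw [Finset.prod_congr rfl this, ← neg_mul]
  congr 1
  subst hb
  cases h : n j <;> simp [hij]

lemma ann_mul_apply {L : ℕ} (j : Fin L) (A : FockOp L) (m n : Occ L) :
    (A * ann j) m n =
      if n j = true then A m (Function.update n j false) * jwSign j n else 0 := by
  rw [Matrix.mul_apply, Finset.sum_eq_single (Function.update n j false)]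
  · by_cases h : n j = true <;> simp [ann, h]
  · intro k _ hk
    simp [ann, hk]
  · simp

lemma cre_apply {L : ℕ} (j : Fin L) (m n : Occ L) :
    (ann j)ᴴ m n = if n j = false ∧ m = Function.update n j true then jwSign j n else 0 := by
  rw [Matrix.conjTranspose_apply, ann, Matrix.of_apply]
  have key : (m j = true ∧ n = Function.update m j false) ↔
      (n j = false ∧ m = Function.update n j true) := by
    constructor
    · rintro ⟨h1, h2⟩
      subst h2
      simp [← h1]
    · rintro ⟨h1, h2⟩
      subst h2
      simp [← h1]
  by_cases h : n j = false ∧ m = Function.update n j true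
  · rw [if_pos h, if_pos (key.2 h), star_jwSign, h.2, jwSign_update_of_le le_rfl]
  · rw [if_neg h, if_neg (fun h' => h (key.1 h')), star_zero]

lemma mul_cre_apply {L : ℕ} (j : Fin L) (A : FockOp L) (m n : Occ L) :
    (A * (ann j)ᴴ) m n =
      if n j = false then A m (Function.update n j true) * jwSign j n else 0 := by
  rw [Matrix.mul_apply, Finset.sum_eq_single (Function.update n j true)]
  · by_cases h : n j = false <;> simp [cre_apply, h, -Matrix.conjTranspose_apply]
  · intro k _ hk
    simp [cre_apply, hk, -Matrix.conjTranspose_apply]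
  · simp

/-- `{a_i, a_j} = 0`. -/
theorem ann_anticomm {L : ℕ} (i j : Fin L) : ann i * ann j + ann j * ann i = 0 := by
  wlog hij : i ≤ j generalizing i j
  · rw [add_comm]
    exact this j i (le_of_not_ge hij)
  ext m n
  rw [Matrix.add_apply, ann_mul_apply, ann_mul_apply, ann, ann, Matrix.of_apply, Matrix.of_apply,
    Matrix.zero_apply]
  rcases hij.eq_or_lt with rfl | hlt
  · simp
  · rw [Function.update_comm hlt.ne, jwSign_update_of_le hij]
    by_cases hi : n i = true <;> by_cases hj : n j = true <;>
      simp [hi, hj, hlt.ne, hlt.ne', jwSign_update_of_lt hlt]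
    split_ifs <;> ring

/-- `{a_i, a_j†} = δ_{i,j}`. -/
theorem ann_cre_anticomm {L : ℕ} (i j : Fin L) :
    ann i * (ann j)ᴴ + (ann j)ᴴ * ann i = if i = j then 1 else 0 := by
  ext m n
  rw [Matrix.add_apply, mul_cre_apply, ann_mul_apply, cre_apply, ann, Matrix.of_apply]
  by_cases hij : i = j
  · subst hij
    rcases h : n i with _ | _
    · have : Function.update n i false = n := by rw [← h, Function.update_eq_self]
      simp [Matrix.one_apply, this, jwSign_update_of_le, jwSign_mul_self]
    · have : Function.update n i true = n := by rw [← h, Function.update_eq_self]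
      simp [Matrix.one_apply, this, jwSign_update_of_le, jwSign_mul_self]
  · rw [if_neg hij, Function.update_comm hij]
    rcases lt_or_gt_of_ne hij with hlt | hlt
    · rw [jwSign_update_of_le hlt.le]
      by_cases hi : n i = true <;> by_cases hj : n j = true <;>
        simp [hi, hj, hij, Ne.symm hij, jwSign_update_of_lt hlt]
      split_ifs <;> ring
    · rw [jwSign_update_of_le (i := j) hlt.le]
      by_cases hi : n i = true <;> by_cases hj : n j = true <;>
        simp [hi, hj, hij, Ne.symm hij, jwSign_update_of_lt hlt]
      split_ifs <;> ring

/-! ### The many-body evolution attached to a mode unitary -/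

lemma freeHamiltonian_comm {L : ℕ} (h : Matrix (Fin L) (Fin L) ℂ) (i : Fin L) :
    freeHamiltonian h * ann i - ann i * freeHamiltonian h = - ∑ j, h i j • ann j := by
  have key : ∀ l m : Fin L, (ann l)ᴴ * ann m * ann i - ann i * ((ann l)ᴴ * ann m) =
      if i = l then - ann m else 0 := by
    intro l m
    have h1 : ann m * ann i = - (ann i * ann m) := eq_neg_of_add_eq_zero_left (ann_anticomm m i)
    have h2 := congrArg (· * ann m) (ann_cre_anticomm i l)
    simp only [add_mul] at h2
    rw [mul_assoc, h1, ← mul_assoc (ann i), mul_neg, ← mul_assoc, ← neg_add', add_comm, h2]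
    split_ifs <;> simp
  simp only [freeHamiltonian, Finset.sum_mul, Finset.mul_sum, ← Finset.sum_sub_distrib,
    smul_mul_assoc, mul_smul_comm, ← smul_sub, key]
  rw [Finset.sum_eq_single i]
  · simp
  · intro l _ hl
    simp [Ne.symm hl]
  · simp

lemma freeHamiltonian_isHermitian {L : ℕ} {h : Matrix (Fin L) (Fin L) ℂ} (hh : h.IsHermitian) :
    (freeHamiltonian h).IsHermitian := by
  unfold freeHamiltonian Matrix.IsHermitian
  simp only [Matrix.conjTranspose_sum, Matrix.conjTranspose_smul, Matrix.conjTranspose_mul,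
    Matrix.conjTranspose_conjTranspose, hh.apply]
  exact Finset.sum_comm

section Evolution

open scoped Matrix.Norms.Operator

lemma exp_conj_sum_ann {L : ℕ} (h : Matrix (Fin L) (Fin L) ℂ) (i : Fin L) :
    NormedSpace.exp (Complex.I • freeHamiltonian h) *
        (∑ j, (NormedSpace.exp (Complex.I • h)) i j • ann j) *
        NormedSpace.exp (-(Complex.I • freeHamiltonian h)) = ann i := by
  set X : FockOp L := Complex.I • freeHamiltonian h with hX
  set Y : Matrix (Fin L) (Fin L) ℂ := Complex.I • h with hY
  have hcomm : ∀ j, X * ann j - ann j * X = - ∑ k, Y j k • ann k := by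
    intro j
    rw [hX, smul_mul_assoc, mul_smul_comm, ← smul_sub, freeHamiltonian_comm, smul_neg,
      Finset.smul_sum]
    simp [hY, smul_smul]
  let b : ℂ → FockOp L := fun t => ∑ j, (NormedSpace.exp (t • Y)) i j • ann j
  have hb : ∀ t, HasDerivAt b (∑ j, (NormedSpace.exp (t • Y) * Y) i j • ann j) t := by
    intro t
    refine HasDerivAt.fun_sum fun j _ => HasDerivAt.smul_const ?_ _
    have := hasDerivAt_exp_smul_const (𝕂 := ℂ) Y t
    exact (hasDerivAt_pi.1 ((hasDerivAt_pi.1 this) i)) j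
  have hXb : ∀ t, X * b t - b t * X = - ∑ j, (NormedSpace.exp (t • Y) * Y) i j • ann j := by
    intro t
    simp only [b, Finset.mul_sum, Finset.sum_mul, mul_smul_comm, smul_mul_assoc,
      ← Finset.sum_sub_distrib, ← smul_sub, hcomm, smul_neg, Finset.sum_neg_distrib,
      Finset.smul_sum, smul_smul, Matrix.mul_apply, Finset.sum_smul]
    rw [Finset.sum_comm]
  let f : ℂ → FockOp L := fun t =>
    NormedSpace.exp (t • X) * b t * NormedSpace.exp (t • (-X))
  have hf : ∀ t, HasDerivAt f 0 t := by
    intro t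
    have h1 := hasDerivAt_exp_smul_const (𝕂 := ℂ) X t
    have h2 := hasDerivAt_exp_smul_const' (𝕂 := ℂ) (-X) t
    refine ((h1.mul (hb t)).mul h2).congr_deriv ?_
    have := hXb t
    rw [sub_eq_iff_eq_add] at this
    rw [mul_assoc _ X, this]
    simp only [Pi.mul_apply]
    noncomm_ring
  have hconst : f 0 = f (1 : ℂ) :=
    is_const_of_deriv_eq_zero (fun t => (hf t).differentiableAt) (fun t => (hf t).deriv) 0 1
  simp only [f, b, zero_smul, one_smul, NormedSpace.exp_zero, one_mul, mul_one] at hconst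
  rw [← hconst]
  simp [Matrix.one_apply]

lemma exp_conj_ann {L : ℕ} (h : Matrix (Fin L) (Fin L) ℂ) (i : Fin L) :
    NormedSpace.exp (Complex.I • freeHamiltonian h) * ann i *
        NormedSpace.exp (-(Complex.I • freeHamiltonian h)) =
      ∑ j, (NormedSpace.exp (-(Complex.I • h))) i j • ann j := by
  have hinv : NormedSpace.exp (-(Complex.I • h)) * NormedSpace.exp (Complex.I • h) = 1 := by
    rw [← Matrix.exp_add_of_commute _ _ (Commute.refl (Complex.I • h)).neg_left]
    simp
  have h1 : ∀ j, (NormedSpace.exp (-(Complex.I • h))) i j • ann j =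
      NormedSpace.exp (Complex.I • freeHamiltonian h) *
        ((NormedSpace.exp (-(Complex.I • h))) i j •
          ∑ k, (NormedSpace.exp (Complex.I • h)) j k • ann k) *
        NormedSpace.exp (-(Complex.I • freeHamiltonian h)) := by
    intro j
    rw [mul_smul_comm, smul_mul_assoc, exp_conj_sum_ann]
  rw [Finset.sum_congr rfl fun j _ => h1 j, ← Finset.sum_mul, ← Finset.mul_sum]
  simp_rw [Finset.smul_sum, smul_smul]
  rw [Finset.sum_comm]
  simp_rw [← Finset.sum_smul, ← Matrix.mul_apply, hinv]
  simp [Matrix.one_apply]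

end Evolution

section Log

open scoped Matrix.Norms.L2Operator

lemma exists_log {L : ℕ} (u : Matrix.unitaryGroup (Fin L) ℂ) :
    ∃ h : Matrix (Fin L) (Fin L) ℂ, h.IsHermitian ∧
      NormedSpace.exp (-(Complex.I • h)) = (u : Matrix (Fin L) (Fin L) ℂ) := by
  have hn : IsStarNormal (u : Matrix (Fin L) (Fin L) ℂ) := inferInstance
  have hfin : (spectrum ℂ (u : Matrix (Fin L) (Fin L) ℂ)).Finite := Matrix.finite_spectrum _
  have hc : ∀ g : ℂ → ℂ, ContinuousOn g (spectrum ℂ (u : Matrix (Fin L) (Fin L) ℂ)) :=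
    fun g => hfin.continuousOn g
  refine ⟨cfc (fun z : ℂ => (-(Complex.arg z) : ℂ)) (u : Matrix (Fin L) (Fin L) ℂ), ?_, ?_⟩
  · rw [Matrix.IsHermitian, ← Matrix.star_eq_conjTranspose, ← cfc_star]
    simp
  · rw [← cfc_smul _ _ _ (hc _), ← cfc_neg, ← CFC.complex_exp_eq_normedSpace_exp
      (cfc_predicate _ _), ← cfc_comp' _ _ _ Complex.continuous_exp.continuousOn (hc _)]
    conv_rhs => rw [← cfc_id' ℂ (u : Matrix (Fin L) (Fin L) ℂ)]
    refine cfc_congr fun z hz => ?_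
    have hz1 : ‖z‖ = 1 := by
      simpa using spectrum.subset_circle_of_unitary u.2 hz
    have := Complex.norm_mul_exp_arg_mul_I z
    rw [hz1] at this
    simpa [mul_comm] using this

end Log

theorem exists_isFreeEvolution {L : ℕ} (u : Matrix.unitaryGroup (Fin L) ℂ) :
    ∃ U : FockOp L, IsFreeEvolution U (u : Matrix (Fin L) (Fin L) ℂ) := by
  obtain ⟨h, hh, hu⟩ := exists_log u
  refine ⟨_, ⟨h, hh, rfl⟩, fun i => ?_⟩
  rw [← hu, ← exp_conj_ann, ← Matrix.exp_conjTranspose, Matrix.conjTranspose_smul,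
    (freeHamiltonian_isHermitian hh).eq]
  simp

/-- The free evolution `U` on Fock space that corresponds to the mode unitary `u`. It is unique: the
mode action fixes `U` up to a phase, and `exp(i H)` fixes the vacuum. -/
def evolution {L : ℕ} (u : Matrix.unitaryGroup (Fin L) ℂ) : FockOp L :=
  (exists_isFreeEvolution u).choose

theorem evolution_spec {L : ℕ} (u : Matrix.unitaryGroup (Fin L) ℂ) :
    IsFreeEvolution (evolution u) (u : Matrix (Fin L) (Fin L) ℂ) :=
  (exists_isFreeEvolution u).choose_spec

/-! ### The symmetric circulant unitaries and their Haar measure -/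

/-- A matrix with `M_{i,j} = M_{i+k,j+k}`, indices modulo `L`. -/
def IsCirculant {L : ℕ} [NeZero L] (M : Matrix (Fin L) (Fin L) ℂ) : Prop :=
  ∀ i j k, M i j = M (i + k) (j + k)

lemma IsCirculant.eq_circulant {L : ℕ} [NeZero L] {M : Matrix (Fin L) (Fin L) ℂ}
    (hM : IsCirculant M) : M = Matrix.circulant fun i => M i 0 := by
  ext i j
  rw [Matrix.circulant_apply, hM i j (-j)]
  simp [sub_eq_add_neg]

/-- The group `CU_Sym(L)` of symmetric circulant unitary matrices. -/
def CUSym (L : ℕ) [NeZero L] : Subgroup (Matrix.unitaryGroup (Fin L) ℂ) where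
  carrier := {u | IsCirculant (u : Matrix (Fin L) (Fin L) ℂ) ∧
    (u : Matrix (Fin L) (Fin L) ℂ).IsSymm}
  one_mem' := by
    refine ⟨fun i j k => ?_, ?_⟩
    · simp [Matrix.one_apply]
    · simp [Matrix.IsSymm]
  mul_mem' := by
    rintro u v ⟨hu, hu'⟩ ⟨hv, hv'⟩
    refine ⟨fun i j k => ?_, ?_⟩
    · simp only [Matrix.UnitaryGroup.mul_val, Matrix.mul_apply]
      refine Fintype.sum_equiv (Equiv.addRight k) _ _ fun s => ?_
      rw [hu i s k, hv s j k]
      rfl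
    · unfold Matrix.IsSymm at *
      rw [Matrix.UnitaryGroup.mul_val, Matrix.transpose_mul, hu', hv', hu.eq_circulant,
        hv.eq_circulant, Matrix.circulant_mul_comm]
  inv_mem' := by
    rintro u ⟨hu, hu'⟩
    refine ⟨fun i j k => ?_, ?_⟩
    · simp only [Matrix.UnitaryGroup.inv_val, Matrix.star_apply]
      rw [hu j i k]
    · rw [Matrix.UnitaryGroup.inv_val, Matrix.star_eq_conjTranspose]
      ext i j
      simp only [Matrix.transpose_apply, Matrix.conjTranspose_apply]
      rw [hu'.apply]

instance (L : ℕ) [NeZero L] : CompactSpace (CUSym L) := by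
  let ι : CUSym L → Matrix (Fin L) (Fin L) ℂ := fun u => (u.1 : Matrix (Fin L) (Fin L) ℂ)
  have hι : Topology.IsEmbedding ι :=
    Topology.IsEmbedding.subtypeVal.comp Topology.IsEmbedding.subtypeVal
  have hrange : ι '' Set.univ = (unitary (Matrix (Fin L) (Fin L) ℂ) : Set _) ∩
      ({M | ∀ i j k, M i j = M (i + k) (j + k)} ∩ {M | Mᵀ = M}) := by
    ext M
    constructor
    · rintro ⟨u, -, rfl⟩
      exact ⟨u.1.2, u.2⟩
    · rintro ⟨h1, h2⟩
      exact ⟨⟨⟨M, h1⟩, h2⟩, trivial, rfl⟩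
  rw [← isCompact_univ_iff, hι.isInducing.isCompact_iff, hrange]
  have hbox : IsCompact (Set.univ.pi fun _ : Fin L => Set.univ.pi fun _ : Fin L =>
      Metric.closedBall (0 : ℂ) 1) :=
    isCompact_univ_pi fun _ => isCompact_univ_pi fun _ => isCompact_closedBall _ _
  have hclosed : IsClosed ((unitary (Matrix (Fin L) (Fin L) ℂ) : Set (Matrix (Fin L) (Fin L) ℂ)) ∩
      ({M | ∀ i j k, M i j = M (i + k) (j + k)} ∩ {M | Mᵀ = M})) := by
    refine isClosed_unitary.inter (IsClosed.inter ?_ ?_)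
    · simp only [Set.ofPred_forall]
      exact isClosed_iInter fun i => isClosed_iInter fun j => isClosed_iInter fun k =>
        isClosed_eq (continuous_id.matrix_elem i j) (continuous_id.matrix_elem _ _)
    · exact isClosed_eq continuous_id.matrix_transpose continuous_id
  refine IsCompact.of_isClosed_subset hbox hclosed ?_
  intro M hM i _ j _
  have hM1 : M ∈ Matrix.unitaryGroup (Fin L) ℂ := hM.1
  simpa using entry_norm_bound_of_unitary hM1 i j

instance (L : ℕ) [NeZero L] : MeasurableSpace (CUSym L) := borel _

instance (L : ℕ) [NeZero L] : BorelSpace (CUSym L) := ⟨rfl⟩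

/-- The Haar measure of `CU_Sym(L)`, normalised to total mass one. -/
def haarCUSym (L : ℕ) [NeZero L] : MeasureTheory.Measure (CUSym L) :=
  MeasureTheory.Measure.haarMeasure ⊤

/-! ### The measurement channel and the two-point operators -/

/-- The operator `|n⟩⟨n|`. -/
def fockProj {L : ℕ} (n : Occ L) : FockOp L := Matrix.single n n 1

/-- The measurement channel
`𝓜(A) = ∑_n E_U ⟨n| U A U† |n⟩ U† |n⟩⟨n| U`, for `U` the free evolution of a Haar random
`u ∈ CU_Sym(L)`; the expectation of an operator is taken entrywise. -/
def channel (L : ℕ) [NeZero L] (A : FockOp L) : FockOp L :=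
  ∑ n : Occ L, Matrix.of fun x y =>
    ∫ u : CUSym L,
      (evolution u.1 * A * (evolution u.1)ᴴ) n n *
        ((evolution u.1)ᴴ * fockProj n * evolution u.1) x y ∂haarCUSym L

/-- The space `W_2` of two-point operators. -/
def W₂ (L : ℕ) : Submodule ℂ (FockOp L) :=
  Submodule.span ℂ {A | ∃ i j : Fin L, A = (ann i)ᴴ * ann j}

/-- The translation-invariant hopping operator `∑_i a_i† a_{i+k}`, indices modulo `L`. -/
def hopping {L : ℕ} [NeZero L] (k : Fin L) : FockOp L :=
  ∑ i : Fin L, (ann i)ᴴ * ann (i + k)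

end FermionShadow

end

open scoped Matrix

noncomputable section

namespace FermionShadow

/-! ### Matrices all of whose symmetric circulant conjugates have zero diagonal -/

section Circulant

set_option linter.unusedSectionVars false

variable {G : Type*} [AddCommGroup G] [Fintype G] [DecidableEq G]

/-! Write a two-point operator as `A = freeHamiltonian x`. Then `Tr(A† 𝓜(A))` is the sum over `n` of
the Haar averages of `|⟨n|UAU†|n⟩|²`. These integrands are continuous and Haar measure charges open
sets, so `𝓜(A) = 0` exactly when every diagonal entry of every `UAU†` vanishes
(`channel_eq_zero_iff`). Since `UAU†` is the free operator of `uᴴxu`, and its diagonal entry at `n`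
sums the diagonal of `uᴴxu` over occupied modes, this says that `uᴴxu` has zero diagonal for every
`u` in the group: `ConjDiagZero x`.

It remains to see that such `x` are the circulants with zero diagonal, which are the combinations of
hopping operators with `k ≠ 0`. One direction holds because circulants commute. For the other, take
for `u` phase changes on the span of the modes `ψ, -ψ`. They give `(QxR)_kk = 0` for orthogonal
projections `Q, R` of this kind (`ConjDiagZero.proj_mul_proj`). Fourier analysis in `k` then kills
the coefficient of `x` between `ψ` and `φ` whenever `φ ≠ ±ψ`; odd order enters because twice a
nontrivial character is nontrivial. The coefficients between `χ` and `-χ` are read off from the zero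
diagonal of `x` itself. Only coefficients between equal modes survive, so `x` is translation
invariant (`ConjDiagZero.shift`).

Orthogonality is a selection rule: each term of the trace carries nonzero charge under some mode's
number operator, hence is traceless. -/

/-- Symmetric matrices indexed by a finite abelian group that are invariant under translations. -/
def IsSymCirculant (u : Matrix G G ℂ) : Prop :=
  (∀ i j k, u i j = u (i + k) (j + k)) ∧ u.IsSymm

/-- Every conjugate of `x` by a symmetric circulant unitary has zero diagonal. -/
def ConjDiagZero (x : Matrix G G ℂ) : Prop :=
  ∀ u ∈ Matrix.unitaryGroup G ℂ, IsSymCirculant u → ∀ k, (uᴴ * x * u) k k = 0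

lemma eq_circulant_of_shift {u : Matrix G G ℂ} (hu : ∀ i j k, u i j = u (i + k) (j + k)) :
    u = Matrix.circulant fun i => u i 0 := by
  ext i j
  rw [Matrix.circulant_apply, hu i j (-j)]
  simp [sub_eq_add_neg]

lemma IsSymCirculant.one : IsSymCirculant (1 : Matrix G G ℂ) :=
  ⟨fun i j k => by simp [Matrix.one_apply], by simp [Matrix.IsSymm]⟩

lemma IsSymCirculant.add {u v : Matrix G G ℂ} (hu : IsSymCirculant u) (hv : IsSymCirculant v) :
    IsSymCirculant (u + v) :=
  ⟨fun i j k => by rw [Matrix.add_apply, Matrix.add_apply, hu.1 i j k, hv.1 i j k], hu.2.add hv.2⟩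

lemma IsSymCirculant.smul {u : Matrix G G ℂ} (hu : IsSymCirculant u) (c : ℂ) :
    IsSymCirculant (c • u) :=
  ⟨fun i j k => by rw [Matrix.smul_apply, Matrix.smul_apply, hu.1 i j k], hu.2.smul c⟩

lemma mul_comm_of_shift {u v : Matrix G G ℂ} (hu : ∀ i j k, u i j = u (i + k) (j + k))
    (hv : ∀ i j k, v i j = v (i + k) (j + k)) : u * v = v * u := by
  rw [eq_circulant_of_shift hu, eq_circulant_of_shift hv, Matrix.circulant_mul_comm]

lemma IsSymCirculant.mul {u v : Matrix G G ℂ} (hu : IsSymCirculant u) (hv : IsSymCirculant v) :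
    IsSymCirculant (u * v) := by
  refine ⟨fun i j k => ?_, ?_⟩
  · simp only [Matrix.mul_apply]
    refine Fintype.sum_equiv (Equiv.addRight k) _ _ fun s => ?_
    rw [hu.1 i s k, hv.1 s j k]
    rfl
  · unfold Matrix.IsSymm
    rw [Matrix.transpose_mul, hu.2.eq, hv.2.eq, mul_comm_of_shift hv.1 hu.1]

lemma ConjDiagZero.conj {x v : Matrix G G ℂ} (hx : ConjDiagZero x)
    (hv : v ∈ Matrix.unitaryGroup G ℂ) (hv' : IsSymCirculant v) : ConjDiagZero (vᴴ * x * v) := by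
  intro u hu hu' k
  have := hx (v * u) (mul_mem hv hu) (hv'.mul hu') k
  rwa [Matrix.conjTranspose_mul, show uᴴ * vᴴ * x * (v * u) = uᴴ * (vᴴ * x * v) * u by
    noncomm_ring] at this

lemma ConjDiagZero.diag {x : Matrix G G ℂ} (hx : ConjDiagZero x) (k : G) : x k k = 0 := by
  simpa using hx 1 (one_mem _) IsSymCirculant.one k

/-! ### Diagonals tested against symmetric circulant projections -/

lemma conj_phase (x Q : Matrix G G ℂ) (hQ : Qᴴ = Q) (z : ℂ) :
    (1 + (z - 1) • Q)ᴴ * x * (1 + (z - 1) • Q) =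
      x + (star z - 1) • (Q * x) + (z - 1) • (x * Q) +
        ((star z - 1) * (z - 1)) • (Q * x * Q) := by
  simp only [Matrix.conjTranspose_add, Matrix.conjTranspose_one, Matrix.conjTranspose_smul, hQ,
    star_sub, star_one, add_mul, mul_add, one_mul, mul_one, smul_mul_assoc, mul_smul_comm,
    smul_add, smul_smul]
  rw [mul_comm (z - 1)]
  abel

lemma phase_mem_unitaryGroup {Q : Matrix G G ℂ} (hQ : Qᴴ = Q) (hQQ : Q * Q = Q) {z : ℂ}
    (hz : star z * z = 1) : 1 + (z - 1) • Q ∈ Matrix.unitaryGroup G ℂ := by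
  rw [Matrix.mem_unitaryGroup_iff', Matrix.star_eq_conjTranspose,
    ← mul_one (1 + (z - 1) • Q)ᴴ, conj_phase _ _ hQ]
  simp only [mul_one, one_mul, hQQ]
  rw [add_assoc, add_assoc, ← add_smul, ← add_smul]
  have : star z - 1 + (z - 1 + (star z - 1) * (z - 1)) = 0 := by linear_combination hz
  rw [this, zero_smul, add_zero]

/-- Conjugating by `1 + (z - 1)Q` with `|z| = 1` gives one linear relation per phase `z` between the
diagonals of `Qx`, `xQ` and `QxQ`. -/
lemma ConjDiagZero.proj {x Q : Matrix G G ℂ} (hx : ConjDiagZero x) (hQ : Qᴴ = Q)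
    (hQQ : Q * Q = Q) (hc : IsSymCirculant Q) (k : G) : (Q * x) k k = (Q * x * Q) k k := by
  have key : ∀ z : ℂ, star z * z = 1 → (star z - 1) * (Q * x) k k + (z - 1) * (x * Q) k k +
      ((star z - 1) * (z - 1)) * (Q * x * Q) k k = 0 := by
    intro z hz
    have := hx _ (phase_mem_unitaryGroup hQ hQQ hz) (IsSymCirculant.one.add (hc.smul _)) k
    rw [conj_phase _ _ hQ] at this
    simpa [hx.diag k] using this
  -- Two phases suffice: `z = I` minus half of `z = -1` gives `(xQ)_kk = (Qx)_kk`, and then `z = -1`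
  -- identifies both with `(QxQ)_kk`.
  have h1 := key (-1) (by simp)
  have h2 := key Complex.I (by simp)
  simp only [star_neg, star_one, Complex.star_def, Complex.conj_I] at h1 h2
  have hI := Complex.I_mul_I
  have h3 : (x * Q) k k = (Q * x) k k := by
    linear_combination (-Complex.I) * (h2 - h1 / 2) + ((x * Q) k k - (Q * x) k k -
      (Q * x * Q) k k * Complex.I) * hI
  linear_combination (-1 / 4) * h1 - (1 / 2) * h3

/-- The reflection `1 - 2R` changes `Qx` by `-2QxR` and leaves `QxQ` alone, because `QR = 0`.
Comparing `ConjDiagZero.proj` before and after the reflection isolates `QxR`. -/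
lemma ConjDiagZero.proj_mul_proj {x Q R : Matrix G G ℂ} (hx : ConjDiagZero x) (hQ : Qᴴ = Q)
    (hQQ : Q * Q = Q) (hQc : IsSymCirculant Q) (hR : Rᴴ = R) (hRR : R * R = R)
    (hRc : IsSymCirculant R) (hQR : Q * R = 0) (k : G) : (Q * x * R) k k = 0 := by
  have hRQ : R * Q = 0 := by rw [mul_comm_of_shift hRc.1 hQc.1, hQR]
  have hu := phase_mem_unitaryGroup hR hRR (z := -1) (by simp)
  have h1 := (hx.conj hu (IsSymCirculant.one.add (hRc.smul _))).proj hQ hQQ hQc k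
  rw [conj_phase _ _ hR] at h1
  simp only [mul_add, add_mul, mul_smul_comm, smul_mul_assoc, ← mul_assoc, hQR, zero_mul,
    smul_zero, add_zero] at h1
  simp only [mul_assoc, hRQ, mul_zero, smul_zero, add_zero] at h1
  have h2 := hx.proj hQ hQQ hQc k
  simp only [Matrix.add_apply, Matrix.smul_apply, mul_assoc, smul_eq_mul] at h1 h2 ⊢
  linear_combination (-1 / 2) * h1 + (1 / 2) * h2

/-! ### Fourier modes -/

/-- The circulant matrix `ψ(i - j)`, a multiple of the projection to the Fourier mode `ψ`. -/
def charMatrix (ψ : AddChar G ℂ) : Matrix G G ℂ := Matrix.of fun i j => ψ (i - j)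

/-- The sum of the Fourier modes `ψ` and `-ψ`. -/
def pairMatrix (ψ : AddChar G ℂ) : Matrix G G ℂ := charMatrix ψ + charMatrix (-ψ)

/-- The matrix entry of `x` between two Fourier modes. -/
def fourierCoeff (x : Matrix G G ℂ) (ψ φ : AddChar G ℂ) : ℂ :=
  ∑ a, ∑ b, ψ (-a) * x a b * φ b

lemma charMatrix_mul_mul_apply (x : Matrix G G ℂ) (ψ φ : AddChar G ℂ) (i j : G) :
    (charMatrix ψ * x * charMatrix φ) i j = fourierCoeff x ψ φ * (ψ i * φ (-j)) := by
  simp only [fourierCoeff, charMatrix, Matrix.mul_apply, Matrix.of_apply, Finset.sum_mul]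
  rw [Finset.sum_comm]
  refine Finset.sum_congr rfl fun a _ => Finset.sum_congr rfl fun b _ => ?_
  rw [sub_eq_add_neg, sub_eq_add_neg, AddChar.map_add_eq_mul, AddChar.map_add_eq_mul]
  ring

lemma charMatrix_mul (ψ φ : AddChar G ℂ) : charMatrix ψ * charMatrix φ =
    if ψ = φ then (Fintype.card G : ℂ) • charMatrix ψ else 0 := by
  have h : ∀ i k, (charMatrix ψ * charMatrix φ) i k = (∑ j, (φ - ψ) j) * (ψ i * φ (-k)) := by
    intro i k
    simp only [charMatrix, Matrix.mul_apply, Matrix.of_apply, Finset.sum_mul]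
    refine Finset.sum_congr rfl fun j _ => ?_
    rw [sub_eq_add_neg, sub_eq_add_neg, AddChar.map_add_eq_mul, AddChar.map_add_eq_mul,
      AddChar.sub_apply]
    ring
  ext i k
  rw [h, AddChar.sum_eq_ite]
  by_cases hψ : ψ = φ
  · subst hψ
    simp [charMatrix, sub_eq_add_neg i k, AddChar.map_add_eq_mul]
  · rw [if_neg hψ, if_neg (by rwa [sub_eq_zero, eq_comm])]
    simp

lemma charMatrix_conjTranspose (ψ : AddChar G ℂ) : (charMatrix ψ)ᴴ = charMatrix ψ := by
  ext i j
  rw [Matrix.conjTranspose_apply, charMatrix, Matrix.of_apply, Matrix.of_apply, ← neg_sub i j,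
    AddChar.map_neg_eq_conj]
  simp

/-- Transposition exchanges the modes `ψ` and `-ψ`; this is why the symmetric group only sees the
two together. -/
lemma isSymCirculant_pairMatrix (ψ : AddChar G ℂ) : IsSymCirculant (pairMatrix ψ) := by
  refine ⟨fun i j k => ?_, ?_⟩
  · simp [pairMatrix, charMatrix]
  · ext i j
    simp [pairMatrix, charMatrix, add_comm]

lemma pairMatrix_conjTranspose (ψ : AddChar G ℂ) : (pairMatrix ψ)ᴴ = pairMatrix ψ := by
  simp [pairMatrix, charMatrix_conjTranspose]

lemma pairMatrix_mul_of_ne {ψ φ : AddChar G ℂ} (h1 : ψ ≠ φ) (h2 : ψ ≠ -φ) :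
    pairMatrix ψ * pairMatrix φ = 0 := by
  have h3 : -ψ ≠ φ := fun h => h2 (by rw [← h, neg_neg])
  have h4 : -ψ ≠ -φ := fun h => h1 (neg_injective h)
  simp [pairMatrix, add_mul, mul_add, charMatrix_mul, h1, h2, h3, h4]

lemma pairMatrix_mul_self (ψ : AddChar G ℂ) :
    ∃ c : ℂ, c ≠ 0 ∧ star c = c ∧ pairMatrix ψ * pairMatrix ψ = c • pairMatrix ψ := by
  have hN : (Fintype.card G : ℂ) ≠ 0 := Nat.cast_ne_zero.2 Fintype.card_ne_zero
  -- A self-conjugate mode is counted twice in `pairMatrix ψ`, which doubles the constant.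
  by_cases h : ψ = -ψ
  · refine ⟨2 * Fintype.card G, by simp [hN], by simp, ?_⟩
    simp only [pairMatrix, ← h, add_mul, mul_add, charMatrix_mul, if_true]
    module
  · refine ⟨Fintype.card G, hN, by simp, ?_⟩
    have h' : -ψ ≠ ψ := fun e => h e.symm
    simp only [pairMatrix, add_mul, mul_add, charMatrix_mul, if_true, if_neg h, if_neg h']
    module

lemma exists_pair_projection (ψ : AddChar G ℂ) : ∃ c : ℂ, c ≠ 0 ∧
    (c • pairMatrix ψ)ᴴ = c • pairMatrix ψ ∧
      (c • pairMatrix ψ) * (c • pairMatrix ψ) = c • pairMatrix ψ := by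
  obtain ⟨c, hc, hs, h⟩ := pairMatrix_mul_self ψ
  refine ⟨c⁻¹, inv_ne_zero hc, ?_, ?_⟩
  · rw [Matrix.conjTranspose_smul, pairMatrix_conjTranspose, star_inv₀, hs]
  · rw [smul_mul_smul_comm, h, smul_smul, mul_assoc, inv_mul_cancel₀ hc, mul_one]

lemma ConjDiagZero.pairMatrix_mul {x : Matrix G G ℂ} (hx : ConjDiagZero x) {ψ φ : AddChar G ℂ}
    (h1 : ψ ≠ φ) (h2 : ψ ≠ -φ) (k : G) : (pairMatrix ψ * x * pairMatrix φ) k k = 0 := by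
  obtain ⟨c, hc, hc1, hc2⟩ := exists_pair_projection ψ
  obtain ⟨d, hd, hd1, hd2⟩ := exists_pair_projection φ
  have := hx.proj_mul_proj hc1 hc2 ((isSymCirculant_pairMatrix ψ).smul c) hd1 hd2
    ((isSymCirculant_pairMatrix φ).smul d)
    (by rw [smul_mul_smul_comm, pairMatrix_mul_of_ne h1 h2, smul_zero]) k
  simpa [hc, hd] using this

/-! ### Vanishing of the Fourier coefficients between distinct modes -/

lemma sum_addChar_eq_zero {ψ : AddChar G ℂ} (h : ψ ≠ 0) : ∑ a, ψ a = 0 :=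
  AddChar.sum_eq_zero_iff_ne_zero.2 h

/-- Each value satisfies both `ψ a ^ 2 = 1` and `ψ a ^ |G| = 1`; for odd `|G|` this forces `ψ a =
1`. -/
lemma addChar_eq_zero_of_add_self (hG : Odd (Fintype.card G)) {ψ : AddChar G ℂ}
    (h : ψ + ψ = 0) : ψ = 0 := by
  obtain ⟨m, hm⟩ := hG
  rw [AddChar.eq_zero_iff] at h ⊢
  intro a
  have h1 : (Fintype.card G) • a = 0 := card_nsmul_eq_zero
  have h2 : ψ a ^ 2 = 1 := by
    rw [sq]
    exact h a
  have h3 : ψ a ^ Fintype.card G = 1 := by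
    rw [← AddChar.map_nsmul_eq_pow, h1, AddChar.map_zero_eq_one]
  rwa [hm, pow_succ, pow_mul, h2, one_pow, one_mul] at h3

lemma ConjDiagZero.fourierCoeff_eq_zero (hG : Odd (Fintype.card G)) {x : Matrix G G ℂ}
    (hx : ConjDiagZero x) {ψ φ : AddChar G ℂ} (h1 : ψ ≠ φ) (h2 : ψ ≠ -φ) :
    fourierCoeff x ψ φ = 0 := by
  have hN : (Fintype.card G : ℂ) ≠ 0 := Nat.cast_ne_zero.2 Fintype.card_ne_zero
  -- The diagonal of `pairMatrix ψ * x * pairMatrix φ`, multiplied by `ψ(-k) φ(k)` so that the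
  -- wanted coefficient no longer depends on `k`. The others carry doubled characters, and summing
  -- over `k` removes those that are nontrivial.
  have hk : ∀ k, fourierCoeff x ψ φ + fourierCoeff x (-ψ) φ * (-(ψ + ψ)) k +
      fourierCoeff x ψ (-φ) * (φ + φ) k +
        fourierCoeff x (-ψ) (-φ) * ((φ - ψ) + (φ - ψ)) k = 0 := by
    intro k
    have := hx.pairMatrix_mul h1 h2 k
    simp only [pairMatrix, add_mul, mul_add, Matrix.add_apply, charMatrix_mul_mul_apply,
      AddChar.neg_apply, neg_neg] at this
    simp only [AddChar.neg_apply, AddChar.add_apply, AddChar.sub_apply]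
    have e1 : ψ k * ψ (-k) = 1 := by rw [← AddChar.map_add_eq_mul]; simp
    have e2 : φ k * φ (-k) = 1 := by rw [← AddChar.map_add_eq_mul]; simp
    linear_combination (ψ (-k) * φ k) * this +
      (-fourierCoeff x ψ φ * (φ k * φ (-k)) - fourierCoeff x ψ (-φ) * φ k * φ k) * e1 +
      (-fourierCoeff x ψ φ - fourierCoeff x (-ψ) φ * ψ (-k) * ψ (-k)) * e2
  have hsum := Finset.sum_eq_zero fun k (_ : k ∈ Finset.univ) => hk k
  have h3 : (φ - ψ) + (φ - ψ) ≠ 0 := fun h =>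
    h1 (sub_eq_zero.1 (addChar_eq_zero_of_add_self hG h)).symm
  simp only [Finset.sum_add_distrib, ← Finset.mul_sum, sum_addChar_eq_zero h3, mul_zero,
    add_zero, Finset.sum_const, Finset.card_univ, nsmul_eq_mul] at hsum
  -- If `ψ` or `φ` is trivial, it coincides with its negative and a second copy of the wanted
  -- coefficient survives the sum, hence the factor 2. Both cannot be trivial, as `ψ ≠ φ`.
  by_cases hψ : ψ = 0
  · subst hψ
    have h4 : φ + φ ≠ 0 := fun h => h1 (addChar_eq_zero_of_add_self hG h).symm
    rw [sum_addChar_eq_zero h4] at hsum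
    simp only [neg_zero, add_zero, AddChar.zero_apply, Finset.sum_const, Finset.card_univ,
      nsmul_eq_mul, mul_zero] at hsum
    have : (2 * (Fintype.card G : ℂ)) * fourierCoeff x 0 φ = 0 := by linear_combination hsum
    simpa [hN] using this
  · have h5 : -(ψ + ψ) ≠ 0 := fun h => hψ (addChar_eq_zero_of_add_self hG (neg_eq_zero.1 h))
    rw [sum_addChar_eq_zero h5] at hsum
    by_cases hφ : φ = 0
    · subst hφ
      simp only [neg_zero, add_zero, AddChar.zero_apply, Finset.sum_const, Finset.card_univ,
        nsmul_eq_mul, mul_zero] at hsum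
      have : (2 * (Fintype.card G : ℂ)) * fourierCoeff x ψ 0 = 0 := by linear_combination hsum
      simpa [hN] using this
    · have h4 : φ + φ ≠ 0 := fun h => hφ (addChar_eq_zero_of_add_self hG h)
      rw [sum_addChar_eq_zero h4] at hsum
      simpa [hN] using hsum

lemma sum_charMatrix : ∑ ψ : AddChar G ℂ, charMatrix ψ = (Fintype.card G : ℂ) • 1 := by
  ext i j
  rw [Matrix.sum_apply]
  simp only [charMatrix, Matrix.of_apply, AddChar.sum_apply_eq_ite, sub_eq_zero]
  simp [Matrix.one_apply]

lemma sum_charMatrix_mul_mul (x : Matrix G G ℂ) :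
    ∑ ψ : AddChar G ℂ, ∑ φ : AddChar G ℂ, charMatrix ψ * x * charMatrix φ =
      ((Fintype.card G : ℂ) * Fintype.card G) • x := by
  simp_rw [← Finset.mul_sum, ← Finset.sum_mul, sum_charMatrix]
  simp [smul_smul]

lemma sum_fourierCoeff (x : Matrix G G ℂ) (i j : G) :
    ∑ ψ : AddChar G ℂ, ∑ φ : AddChar G ℂ, fourierCoeff x ψ φ * (ψ i * φ (-j)) =
      ((Fintype.card G : ℂ) * Fintype.card G) * x i j := by
  rw [← smul_eq_mul, ← Matrix.smul_apply, ← sum_charMatrix_mul_mul, Matrix.sum_apply]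
  refine Finset.sum_congr rfl fun ψ _ => ?_
  rw [Matrix.sum_apply]
  exact Finset.sum_congr rfl fun φ _ => (charMatrix_mul_mul_apply x ψ φ i j).symm

/-- The component of the diagonal of `x` along the character `χ + χ` collects the coefficients with
`ψ - φ = χ + χ`. Those with `φ ≠ ±ψ` are already zero, `φ = ψ` would force `χ = 0`, and `φ = -ψ`
forces `ψ = χ` by odd order. -/
lemma ConjDiagZero.fourierCoeff_neg_eq_zero (hG : Odd (Fintype.card G)) {x : Matrix G G ℂ}
    (hx : ConjDiagZero x) {χ : AddChar G ℂ} (hχ : χ ≠ 0) : fourierCoeff x χ (-χ) = 0 := by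
  have hN : (Fintype.card G : ℂ) ≠ 0 := Nat.cast_ne_zero.2 Fintype.card_ne_zero
  have hχ' : χ ≠ -χ := fun h => hχ (addChar_eq_zero_of_add_self hG (by nth_rw 2 [h]; simp))
  have hk : ∀ k, ∑ ψ : AddChar G ℂ, ∑ φ : AddChar G ℂ,
      fourierCoeff x ψ φ * ((ψ - φ) - (χ + χ)) k = 0 := by
    intro k
    have h := sum_fourierCoeff x k k
    rw [hx.diag, mul_zero] at h
    have h' := congrArg (· * (-(χ + χ)) k) h
    simp only [Finset.sum_mul, zero_mul] at h'
    rw [← h']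
    refine Finset.sum_congr rfl fun ψ _ => Finset.sum_congr rfl fun φ _ => ?_
    simp only [AddChar.sub_apply, AddChar.neg_apply, AddChar.add_apply]
    ring
  have hsum := Finset.sum_eq_zero fun k (_ : k ∈ Finset.univ) => hk k
  rw [Finset.sum_comm, Finset.sum_eq_single χ, Finset.sum_comm, Finset.sum_eq_single (-χ)] at hsum
  · simpa [hN] using hsum
  · intro φ _ hφ
    rw [← Finset.mul_sum]
    by_cases h : χ = φ
    · subst h
      rw [sum_addChar_eq_zero, mul_zero]
      rw [sub_self, zero_sub, neg_ne_zero]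
      exact fun h => hχ (addChar_eq_zero_of_add_self hG h)
    · rw [hx.fourierCoeff_eq_zero hG h (fun h' => hφ (by rw [h', neg_neg])), zero_mul]
  · simp
  · intro ψ _ hψ
    rw [Finset.sum_comm]
    refine Finset.sum_eq_zero fun φ _ => ?_
    rw [← Finset.mul_sum]
    by_cases h : ψ = φ
    · subst h
      rw [sum_addChar_eq_zero, mul_zero]
      rw [sub_self, zero_sub, neg_ne_zero]
      exact fun h => hχ (addChar_eq_zero_of_add_self hG h)
    by_cases h' : ψ = -φ
    · obtain rfl : φ = -ψ := by rw [h', neg_neg]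
      rw [sum_addChar_eq_zero, mul_zero]
      intro h0
      refine hψ (sub_eq_zero.1 (addChar_eq_zero_of_add_self hG ?_))
      rw [← h0]
      abel
    · rw [hx.fourierCoeff_eq_zero hG h h', zero_mul]
  · simp

/-- Only the coefficients with `φ = ψ` remain, and their contribution `ψ(i) ψ(-j)` depends on `i -
j` alone. -/
theorem ConjDiagZero.shift (hG : Odd (Fintype.card G)) {x : Matrix G G ℂ} (hx : ConjDiagZero x)
    (i j k : G) : x i j = x (i + k) (j + k) := by
  have hN : (Fintype.card G : ℂ) ≠ 0 := Nat.cast_ne_zero.2 Fintype.card_ne_zero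
  refine mul_left_cancel₀ (mul_ne_zero hN hN) ?_
  rw [← sum_fourierCoeff, ← sum_fourierCoeff]
  refine Finset.sum_congr rfl fun ψ _ => Finset.sum_congr rfl fun φ _ => ?_
  by_cases h : ψ = φ
  · subst h
    rw [← AddChar.map_add_eq_mul, ← AddChar.map_add_eq_mul]
    congr 2
    abel
  · suffices fourierCoeff x ψ φ = 0 by rw [this, zero_mul, zero_mul]
    by_cases h' : ψ = -φ
    · obtain rfl : φ = -ψ := by rw [h', neg_neg]
      exact hx.fourierCoeff_neg_eq_zero hG (by rintro rfl; simp at h)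
    · exact hx.fourierCoeff_eq_zero hG h h'

theorem conjDiagZero_of_shift {x : Matrix G G ℂ} (hx : ∀ i j k, x i j = x (i + k) (j + k))
    (h0 : ∀ k, x k k = 0) : ConjDiagZero x := by
  intro u hu hu' k
  rw [mul_assoc, mul_comm_of_shift hx hu'.1, ← mul_assoc, ← Matrix.star_eq_conjTranspose,
    Matrix.mem_unitaryGroup_iff'.1 hu, one_mul, h0]

end Circulant

/-! ### Free evolutions acting on two-point operators -/

lemma cre_mul_ann_apply_diag {L : ℕ} (i j : Fin L) (n : Occ L) :
    ((ann i)ᴴ * ann j) n n = if i = j ∧ n i = true then 1 else 0 := by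
  rw [ann_mul_apply, cre_apply]
  by_cases hij : i = j
  · subst hij
    rcases h : n i with _ | _
    · simp
    · have : Function.update n i true = n := by rw [← h, Function.update_eq_self]
      simp [jwSign_update_of_le, this, jwSign_mul_self]
  · have : ¬ ((Function.update n j false) i = false ∧
        n = Function.update (Function.update n j false) i true) ∨ n j = false := by
      rcases h : n j with _ | _
      · exact Or.inr rfl
      · refine Or.inl fun h' => ?_
        have := congrFun h'.2 j
        simp [Ne.symm hij, h] at this
    rcases this with h | h
    · rw [if_neg h]
      simp [hij]
    · simp [h, hij]

lemma cre_mul_ann_self {L : ℕ} (i : Fin L) :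
    (ann i)ᴴ * ann i = Matrix.diagonal fun n : Occ L => if n i = true then (1 : ℂ) else 0 := by
  ext m n
  by_cases hmn : m = n
  · subst hmn
    rw [cre_mul_ann_apply_diag]
    simp
  · rw [Matrix.diagonal_apply_ne _ hmn, ann_mul_apply, cre_apply]
    rcases h : n i with _ | _
    · simp
    · have : Function.update n i true = n := by rw [← h, Function.update_eq_self]
      simp [this, hmn]

lemma freeHamiltonian_apply_diag {L : ℕ} (x : Matrix (Fin L) (Fin L) ℂ) (n : Occ L) :
    freeHamiltonian x n n = ∑ k, if n k = true then x k k else 0 := by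
  simp only [freeHamiltonian, Matrix.sum_apply, Matrix.smul_apply, cre_mul_ann_apply_diag,
    smul_eq_mul, mul_ite, mul_one, mul_zero]
  refine Finset.sum_congr rfl fun k _ => ?_
  rw [Finset.sum_eq_single k]
  · simp
  · intro j _ hj
    simp [Ne.symm hj]
  · simp

lemma freeHamiltonian_add {L : ℕ} (x y : Matrix (Fin L) (Fin L) ℂ) :
    freeHamiltonian (x + y) = freeHamiltonian x + freeHamiltonian y := by
  simp [freeHamiltonian, add_smul, Finset.sum_add_distrib]

lemma freeHamiltonian_smul {L : ℕ} (c : ℂ) (x : Matrix (Fin L) (Fin L) ℂ) :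
    freeHamiltonian (c • x) = c • freeHamiltonian x := by
  simp [freeHamiltonian, Finset.smul_sum, smul_smul]

lemma freeHamiltonian_single {L : ℕ} (i j : Fin L) :
    freeHamiltonian (Matrix.single i j 1) = (ann i)ᴴ * ann j := by
  unfold freeHamiltonian
  rw [Finset.sum_eq_single i, Finset.sum_eq_single j]
  · simp
  · intro k _ hk
    simp [Matrix.single, Ne.symm hk]
  · simp
  · intro k _ hk
    simp [Matrix.single, Ne.symm hk]
  · simp

lemma mem_W₂_iff {L : ℕ} {A : FockOp L} : A ∈ W₂ L ↔ ∃ x, A = freeHamiltonian x := by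
  constructor
  · intro hA
    induction hA using Submodule.span_induction with
    | mem A hA =>
      obtain ⟨i, j, rfl⟩ := hA
      exact ⟨_, (freeHamiltonian_single i j).symm⟩
    | zero => exact ⟨0, by simp [freeHamiltonian]⟩
    | add A B _ _ hA hB =>
      obtain ⟨x, rfl⟩ := hA
      obtain ⟨y, rfl⟩ := hB
      exact ⟨x + y, (freeHamiltonian_add x y).symm⟩
    | smul c A _ hA =>
      obtain ⟨x, rfl⟩ := hA
      exact ⟨c • x, (freeHamiltonian_smul c x).symm⟩
  · rintro ⟨x, rfl⟩
    exact Submodule.sum_mem _ fun i _ => Submodule.sum_mem _ fun j _ =>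
      Submodule.smul_mem _ _ (Submodule.subset_span ⟨i, j, rfl⟩)

lemma IsFreeEvolution.conjTranspose_mul {L : ℕ} {U : FockOp L} {u : Matrix (Fin L) (Fin L) ℂ}
    (hU : IsFreeEvolution U u) : Uᴴ * U = 1 := by
  obtain ⟨⟨h, hh, rfl⟩, -⟩ := hU
  rw [← Matrix.exp_conjTranspose, Matrix.conjTranspose_smul, (freeHamiltonian_isHermitian hh).eq,
    ← Matrix.exp_add_of_commute]
  · simp
  · simp only [Complex.star_def, Complex.conj_I, neg_smul]
    exact (Commute.refl _).neg_left

lemma IsFreeEvolution.mul_conjTranspose {L : ℕ} {U : FockOp L} {u : Matrix (Fin L) (Fin L) ℂ}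
    (hU : IsFreeEvolution U u) : U * Uᴴ = 1 :=
  mul_eq_one_comm.1 hU.conjTranspose_mul

lemma IsFreeEvolution.conj_cre {L : ℕ} {U : FockOp L} {u : Matrix (Fin L) (Fin L) ℂ}
    (hU : IsFreeEvolution U u) (i : Fin L) :
    U * (ann i)ᴴ * Uᴴ = ∑ k, star (u i k) • (ann k)ᴴ := by
  have := congrArg Matrix.conjTranspose (hU.2 i)
  simpa only [Matrix.conjTranspose_mul, Matrix.conjTranspose_conjTranspose, Matrix.mul_assoc,
    Matrix.conjTranspose_sum, Matrix.conjTranspose_smul] using this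

/-- The right-hand side depends on `u` only. This gives access to the evolved operators even though
`evolution u` is obtained by choice. -/
lemma IsFreeEvolution.conj_freeHamiltonian {L : ℕ} {U : FockOp L}
    {u : Matrix (Fin L) (Fin L) ℂ} (hU : IsFreeEvolution U u) (x : Matrix (Fin L) (Fin L) ℂ) :
    U * freeHamiltonian x * Uᴴ = freeHamiltonian (uᴴ * x * u) := by
  have h : ∀ i j, U * ((ann i)ᴴ * ann j) * Uᴴ =
      ∑ k, ∑ l, (star (u i k) * u j l) • ((ann k)ᴴ * ann l) := by
    intro i j
    have : U * ((ann i)ᴴ * ann j) * Uᴴ = (U * (ann i)ᴴ * Uᴴ) * (U * ann j * Uᴴ) := by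
      calc U * ((ann i)ᴴ * ann j) * Uᴴ = U * (ann i)ᴴ * 1 * ann j * Uᴴ := by noncomm_ring
        _ = _ := by rw [← hU.conjTranspose_mul]; noncomm_ring
    rw [this, hU.conj_cre, hU.2, Finset.sum_mul]
    simp only [Finset.mul_sum, smul_mul_smul_comm]
  simp only [freeHamiltonian, Finset.mul_sum, Finset.sum_mul, mul_smul_comm, smul_mul_assoc, h,
    Matrix.mul_apply, Finset.sum_smul, Finset.smul_sum, smul_smul, Matrix.conjTranspose_apply]
  have e1 : ∀ F : Fin L → Fin L → Fin L → Fin L → FockOp L,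
      ∑ i, ∑ j, ∑ k, ∑ l, F i j k l = ∑ k, ∑ l, ∑ j, ∑ i, F i j k l := by
    intro F
    rw [Finset.sum_comm, Finset.sum_congr rfl fun j _ => Finset.sum_comm, Finset.sum_comm]
    refine Finset.sum_congr rfl fun k _ => ?_
    rw [Finset.sum_congr rfl fun j _ => Finset.sum_comm, Finset.sum_comm]
  rw [e1]
  refine Finset.sum_congr rfl fun k _ => Finset.sum_congr rfl fun l _ =>
    Finset.sum_congr rfl fun j _ => Finset.sum_congr rfl fun i _ => ?_
  congr 1
  ring

lemma IsFreeEvolution.conjTranspose_conj_freeHamiltonian {L : ℕ} {U : FockOp L}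
    {u : Matrix (Fin L) (Fin L) ℂ} (hU : IsFreeEvolution U u)
    (hu : u ∈ Matrix.unitaryGroup (Fin L) ℂ) (x : Matrix (Fin L) (Fin L) ℂ) :
    Uᴴ * freeHamiltonian x * U = freeHamiltonian (u * x * uᴴ) := by
  have h1 : uᴴ * u = 1 := Matrix.mem_unitaryGroup_iff'.1 hu
  have h2 : x = uᴴ * (u * x * uᴴ) * u := by
    calc x = 1 * x * 1 := by simp
      _ = _ := by rw [← h1]; noncomm_ring
  calc Uᴴ * freeHamiltonian x * U
      = Uᴴ * (U * freeHamiltonian (u * x * uᴴ) * Uᴴ) * U := by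
        rw [hU.conj_freeHamiltonian, ← h2]
    _ = (Uᴴ * U) * freeHamiltonian (u * x * uᴴ) * (Uᴴ * U) := by noncomm_ring
    _ = _ := by rw [hU.conjTranspose_mul, one_mul, mul_one]

/-! ### Continuity of the evolved Fock projections -/

/-- The projection onto occupation `b` of mode `i`. -/
def occProj {L : ℕ} (i : Fin L) (b : Bool) : FockOp L :=
  if b = true then freeHamiltonian (Matrix.single i i 1)
  else 1 - freeHamiltonian (Matrix.single i i 1)

lemma occProj_eq_diagonal {L : ℕ} (i : Fin L) (b : Bool) :
    occProj i b = Matrix.diagonal fun n : Occ L => if n i = b then (1 : ℂ) else 0 := by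
  rw [occProj, freeHamiltonian_single, cre_mul_ann_self]
  cases b
  · simp only [Bool.false_eq_true, if_false]
    rw [← Matrix.diagonal_one, Matrix.diagonal_sub]
    congr 1
    ext n
    cases h : n i <;> simp
  · simp

/-- Reduces `|n⟩⟨n|` to two-point operators and the identity, whose evolution is explicit in `u`. -/
lemma fockProj_eq_prod {L : ℕ} (n : Occ L) :
    fockProj n = ((List.finRange L).map fun i => occProj i (n i)).prod := by
  have h : ∀ i : Fin L, occProj i (n i) = Matrix.diagonalRingHom (Occ L) ℂ
      (fun m : Occ L => if m i = n i then (1 : ℂ) else 0) := fun i => occProj_eq_diagonal i (n i)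
  simp only [h]
  have := map_list_prod (Matrix.diagonalRingHom (Occ L) ℂ)
    ((List.finRange L).map fun i => fun m : Occ L => if m i = n i then (1 : ℂ) else 0)
  rw [List.map_map] at this
  refine Eq.trans ?_ this
  rw [← List.ofFn_eq_map, List.prod_ofFn]
  ext x y
  rw [fockProj, Matrix.diagonalRingHom_apply, Matrix.diagonal_apply, Finset.prod_apply,
    Finset.prod_ite_zero, Matrix.single_apply]
  by_cases hx : n = x
  · subst hx
    simp
  · have : ¬ ∀ i ∈ Finset.univ, x i = n i := fun h' => hx (funext fun i => (h' i (by simp)).symm)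
    rw [if_neg this, if_neg (fun h' => hx h'.1), ite_self]

lemma conj_list_prod {L : ℕ} {U : FockOp L} (h1 : U * Uᴴ = 1) (h2 : Uᴴ * U = 1)
    (l : List (FockOp L)) : Uᴴ * l.prod * U = (l.map fun A => Uᴴ * A * U).prod := by
  induction l with
  | nil => simp [h2]
  | cons A l ih =>
    rw [List.map_cons, List.prod_cons, List.prod_cons, ← ih]
    calc Uᴴ * (A * l.prod) * U = Uᴴ * A * 1 * l.prod * U := by noncomm_ring
      _ = _ := by rw [← h1]; noncomm_ring

lemma continuous_freeHamiltonian {L : ℕ} :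
    Continuous (freeHamiltonian : Matrix (Fin L) (Fin L) ℂ → FockOp L) := by
  unfold freeHamiltonian
  refine continuous_finsetSum _ fun i _ => continuous_finsetSum _ fun j _ => ?_
  exact (continuous_id.matrix_elem i j).smul continuous_const

/-- Continuity of the chosen `u ↦ U` itself is never needed: `U†|n⟩⟨n|U` is a product of evolved
occupation projections, each continuous in the entries of `u`. -/
lemma continuous_conj_fockProj {L : ℕ} (n : Occ L) :
    Continuous fun u : Matrix.unitaryGroup (Fin L) ℂ =>
      (evolution u)ᴴ * fockProj n * evolution u := by
  have h : ∀ u : Matrix.unitaryGroup (Fin L) ℂ, (evolution u)ᴴ * fockProj n * evolution u =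
      ((List.finRange L).map fun i => (evolution u)ᴴ * occProj i (n i) * evolution u).prod := by
    intro u
    rw [fockProj_eq_prod, conj_list_prod (evolution_spec u).mul_conjTranspose
      (evolution_spec u).conjTranspose_mul, List.map_map]
    rfl
  simp only [h]
  refine continuous_list_prod _ fun i _ => ?_
  have hc : Continuous fun u : Matrix.unitaryGroup (Fin L) ℂ =>
      (evolution u)ᴴ * freeHamiltonian (Matrix.single i i 1) * evolution u := by
    simp only [fun u : Matrix.unitaryGroup (Fin L) ℂ =>
      (evolution_spec u).conjTranspose_conj_freeHamiltonian u.2 (Matrix.single i i 1)]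
    have hv : Continuous fun u : Matrix.unitaryGroup (Fin L) ℂ =>
      (u : Matrix (Fin L) (Fin L) ℂ) := continuous_subtype_val
    exact continuous_freeHamiltonian.comp
      ((hv.matrix_mul continuous_const).matrix_mul hv.matrix_conjTranspose)
  unfold occProj
  split_ifs
  · exact hc
  · simp only [mul_sub, sub_mul, mul_one,
      fun u : Matrix.unitaryGroup (Fin L) ℂ => (evolution_spec u).conjTranspose_mul]
    exact continuous_const.sub hc

lemma continuous_conj_freeHamiltonian {L : ℕ} (x : Matrix (Fin L) (Fin L) ℂ) :
    Continuous fun u : Matrix.unitaryGroup (Fin L) ℂ =>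
      evolution u * freeHamiltonian x * (evolution u)ᴴ := by
  simp only [fun u : Matrix.unitaryGroup (Fin L) ℂ => (evolution_spec u).conj_freeHamiltonian x]
  have hv : Continuous fun u : Matrix.unitaryGroup (Fin L) ℂ =>
    (u : Matrix (Fin L) (Fin L) ℂ) := continuous_subtype_val
  exact continuous_freeHamiltonian.comp
    ((hv.matrix_conjTranspose.matrix_mul continuous_const).matrix_mul hv)

/-! ### The kernel of the measurement channel -/

instance (L : ℕ) [NeZero L] : (haarCUSym L).IsHaarMeasure := by
  unfold haarCUSym
  infer_instance

lemma trace_conjTranspose_mul_conj_fockProj {L : ℕ} (A U : FockOp L) (n : Occ L) :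
    (Aᴴ * (Uᴴ * fockProj n * U)).trace = star ((U * A * Uᴴ) n n) := by
  have h : Aᴴ * (Uᴴ * fockProj n * U) = (Aᴴ * Uᴴ * fockProj n) * U := by noncomm_ring
  rw [h, Matrix.trace_mul_comm, ← Matrix.conjTranspose_apply, Matrix.conjTranspose_mul,
    Matrix.conjTranspose_mul, Matrix.conjTranspose_conjTranspose, fockProj, ← Matrix.mul_assoc,
    Matrix.trace_mul_single]
  simp

/-- `Tr(A† U†|n⟩⟨n|U)` is the conjugate of `⟨n|UAU†|n⟩`, so the integrand becomes a squared modulus.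
Membership in `W₂` supplies the continuity, hence the integrability, needed to exchange trace and
integral. -/
lemma trace_conjTranspose_mul_channel {L : ℕ} [NeZero L] {A : FockOp L} (hA : A ∈ W₂ L) :
    (Aᴴ * channel L A).trace = ((∑ n : Occ L, ∫ u : CUSym L,
      Complex.normSq ((evolution u.1 * A * (evolution u.1)ᴴ) n n) ∂haarCUSym L : ℝ) : ℂ) := by
  obtain ⟨x, rfl⟩ := mem_W₂_iff.1 hA
  set A := freeHamiltonian x
  have hf : ∀ n : Occ L, Continuous fun u : CUSym L =>
      (evolution u.1 * A * (evolution u.1)ᴴ) n n := fun n =>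
    ((continuous_conj_freeHamiltonian x).comp continuous_subtype_val).matrix_elem n n
  have hg : ∀ n i j : Occ L, Continuous fun u : CUSym L =>
      ((evolution u.1)ᴴ * fockProj n * evolution u.1) i j := fun n i j =>
    ((continuous_conj_fockProj n).comp continuous_subtype_val).matrix_elem i j
  have hint : ∀ F : CUSym L → ℂ, Continuous F → MeasureTheory.Integrable F (haarCUSym L) :=
    fun F hF => hF.integrable_of_hasCompactSupport (HasCompactSupport.of_compactSpace _)
  unfold channel
  rw [Finset.mul_sum, Matrix.trace_sum, Complex.ofReal_sum]
  refine Finset.sum_congr rfl fun n _ => ?_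
  have key : ∀ u : CUSym L, ∑ j, ∑ i, Aᴴ j i *
      ((evolution u.1 * A * (evolution u.1)ᴴ) n n *
        ((evolution u.1)ᴴ * fockProj n * evolution u.1) i j) =
      (Complex.normSq ((evolution u.1 * A * (evolution u.1)ᴴ) n n) : ℂ) := by
    intro u
    rw [Complex.normSq_eq_conj_mul_self, ← Complex.star_def,
      ← trace_conjTranspose_mul_conj_fockProj, Matrix.trace, Finset.sum_mul]
    refine Finset.sum_congr rfl fun j _ => ?_
    rw [Matrix.diag_apply, Matrix.mul_apply (M := Aᴴ), Finset.sum_mul]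
    exact Finset.sum_congr rfl fun i _ => by ring
  rw [← integral_complex_ofReal]
  simp only [← key]
  rw [MeasureTheory.integral_finsetSum]
  · refine Finset.sum_congr rfl fun j _ => ?_
    rw [MeasureTheory.integral_finsetSum, Matrix.diag_apply, Matrix.mul_apply]
    · refine Finset.sum_congr rfl fun i _ => ?_
      rw [MeasureTheory.integral_const_mul, Matrix.of_apply]
    · exact fun i _ => hint _ (continuous_const.mul ((hf n).mul (hg n i j)))
  · exact fun j _ => hint _ (continuous_finsetSum _ fun i _ =>
      continuous_const.mul ((hf n).mul (hg n i j)))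

lemma channel_eq_zero_iff {L : ℕ} [NeZero L] (x : Matrix (Fin L) (Fin L) ℂ) :
    channel L (freeHamiltonian x) = 0 ↔ ∀ (u : CUSym L) (n : Occ L),
      (evolution u.1 * freeHamiltonian x * (evolution u.1)ᴴ) n n = 0 := by
  constructor
  · intro h
    have htr := trace_conjTranspose_mul_channel (mem_W₂_iff.2 ⟨x, rfl⟩)
    rw [h, mul_zero, Matrix.trace_zero, eq_comm, Complex.ofReal_eq_zero,
      Finset.sum_eq_zero_iff_of_nonneg fun n _ =>
        MeasureTheory.integral_nonneg fun u => Complex.normSq_nonneg _] at htr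
    intro u n
    have hc : Continuous fun u : CUSym L => Complex.normSq
        ((evolution u.1 * freeHamiltonian x * (evolution u.1)ᴴ) n n) :=
      Complex.continuous_normSq.comp
        (((continuous_conj_freeHamiltonian x).comp continuous_subtype_val).matrix_elem n n)
    by_contra hne
    have hpos := hc.integral_pos_of_hasCompactSupport_nonneg_nonzero (μ := haarCUSym L) (x := u)
      (HasCompactSupport.of_compactSpace _) (fun u => Complex.normSq_nonneg _)
      (by rwa [Ne, Complex.normSq_eq_zero])
    exact hpos.ne' (htr n (Finset.mem_univ n))
  · intro h
    unfold channel
    refine Finset.sum_eq_zero fun n _ => ?_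
    ext i j
    simp [h]

lemma channel_eq_zero_iff_conjDiagZero {L : ℕ} [NeZero L] (x : Matrix (Fin L) (Fin L) ℂ) :
    channel L (freeHamiltonian x) = 0 ↔ ConjDiagZero x := by
  rw [channel_eq_zero_iff]
  simp only [fun u : CUSym L => (evolution_spec u.1).conj_freeHamiltonian x,
    freeHamiltonian_apply_diag]
  constructor
  · intro h u hu hu' k
    -- The state with a single particle in mode `k` picks out one diagonal entry.
    have := h ⟨⟨u, hu⟩, hu'⟩ fun i => decide (i = k)
    simpa using this
  · intro h u n
    refine Finset.sum_eq_zero fun k _ => ?_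
    rw [h _ u.1.2 u.2 k, ite_self]

/-! ### Hopping operators as circulants with zero diagonal -/

lemma hopping_eq_freeHamiltonian {L : ℕ} [NeZero L] (k : Fin L) :
    hopping k = freeHamiltonian (Matrix.of fun i j => if j = i + k then (1 : ℂ) else 0) := by
  simp [hopping, freeHamiltonian]

lemma mem_span_hopping_iff {L : ℕ} [NeZero L] {A : FockOp L} :
    A ∈ Submodule.span ℂ {A : FockOp L | ∃ k : Fin L, k ≠ 0 ∧ A = hopping k} ↔
      ∃ x : Matrix (Fin L) (Fin L) ℂ, (∀ i j k, x i j = x (i + k) (j + k)) ∧ (∀ k, x k k = 0) ∧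
        A = freeHamiltonian x := by
  constructor
  · intro hA
    induction hA using Submodule.span_induction with
    | mem A hA =>
      obtain ⟨k, hk, rfl⟩ := hA
      refine ⟨_, fun i j l => ?_, fun i => ?_, hopping_eq_freeHamiltonian k⟩
      · simp only [Matrix.of_apply]
        simp only [add_right_comm i l k, add_left_inj]
      · simp [hk]
    | zero => exact ⟨0, by simp, by simp, by simp [freeHamiltonian]⟩
    | add A B _ _ hA hB =>
      obtain ⟨x, hx, hx0, rfl⟩ := hA
      obtain ⟨y, hy, hy0, rfl⟩ := hB
      exact ⟨x + y, fun i j k => by rw [Matrix.add_apply, Matrix.add_apply, hx i j k, hy i j k],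
        fun k => by rw [Matrix.add_apply, hx0, hy0, add_zero], (freeHamiltonian_add x y).symm⟩
    | smul c A _ hA =>
      obtain ⟨x, hx, hx0, rfl⟩ := hA
      exact ⟨c • x, fun i j k => by rw [Matrix.smul_apply, Matrix.smul_apply, hx i j k],
        fun k => by rw [Matrix.smul_apply, hx0, smul_zero], (freeHamiltonian_smul c x).symm⟩
  · rintro ⟨x, hx, hx0, rfl⟩
    -- Translation invariance gives `x i (i + k) = x 0 k`; the `k = 0` term drops out because the
    -- diagonal is zero.
    have h : freeHamiltonian x = ∑ k : Fin L, x 0 k • hopping k := by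
      unfold freeHamiltonian hopping
      simp only [Finset.smul_sum]
      rw [Finset.sum_comm (f := fun k i => x 0 k • ((ann i)ᴴ * ann (i + k)))]
      refine Finset.sum_congr rfl fun i _ =>
        (Fintype.sum_equiv (Equiv.addLeft i) _ _ fun k => ?_).symm
      simp only [Equiv.coe_addLeft]
      rw [hx 0 k i, zero_add, add_comm k i]
    rw [h]
    refine Submodule.sum_mem _ fun k _ => ?_
    by_cases hk : k = 0
    · subst hk
      rw [hx0, zero_smul]
      exact Submodule.zero_mem _
    · exact Submodule.smul_mem _ _ (Submodule.subset_span ⟨k, hk, rfl⟩)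

/-! ### Hilbert–Schmidt orthogonality -/

lemma trace_eq_zero_of_commutator {n : Type*} [Fintype n] {N T : Matrix n n ℂ} {c : ℂ}
    (hc : c ≠ 0) (h : N * T - T * N = c • T) : T.trace = 0 := by
  have := congrArg Matrix.trace h
  rw [Matrix.trace_sub, Matrix.trace_mul_comm, sub_self, Matrix.trace_smul, eq_comm] at this
  simpa [hc] using this

lemma number_comm_ann {L : ℕ} (m i : Fin L) :
    (ann m)ᴴ * ann m * ann i - ann i * ((ann m)ᴴ * ann m) =
      (if i = m then (-1 : ℂ) else 0) • ann i := by
  have := freeHamiltonian_comm (Matrix.single m m (1 : ℂ)) i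
  rw [freeHamiltonian_single] at this
  rw [this]
  by_cases h : i = m
  · subst h
    simp [Matrix.single_apply]
  · simp [h, Ne.symm h]

lemma number_comm_cre {L : ℕ} (m i : Fin L) :
    (ann m)ᴴ * ann m * (ann i)ᴴ - (ann i)ᴴ * ((ann m)ᴴ * ann m) =
      (if i = m then (1 : ℂ) else 0) • (ann i)ᴴ := by
  have := congrArg Matrix.conjTranspose (number_comm_ann m i)
  simp only [Matrix.conjTranspose_sub, Matrix.conjTranspose_smul, Matrix.conjTranspose_mul,
    Matrix.conjTranspose_conjTranspose] at this
  rw [← neg_sub, this, ← neg_smul]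
  split_ifs <;> simp

lemma comm_mul {R : Type*} [Ring R] [Algebra ℂ R] {N S T : R} {c d : ℂ}
    (hS : N * S - S * N = c • S) (hT : N * T - T * N = d • T) :
    N * (S * T) - (S * T) * N = (c + d) • (S * T) := by
  calc N * (S * T) - (S * T) * N = (N * S - S * N) * T + S * (N * T - T * N) := by noncomm_ring
    _ = _ := by rw [hS, hT, smul_mul_assoc, mul_smul_comm, add_smul]

/-- The hypothesis says that the product has nonzero charge in mode `m`; it is then a multiple of a
commutator with the number operator of `m`, so its trace vanishes. -/
lemma trace_cre_ann_cre_ann_eq_zero {L : ℕ} (a b c d m : Fin L)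
    (h : (((if a = m then (1 : ℂ) else 0) + if b = m then (-1 : ℂ) else 0) +
      ((if c = m then (1 : ℂ) else 0) + if d = m then (-1 : ℂ) else 0)) ≠ 0) :
    ((ann a)ᴴ * ann b * ((ann c)ᴴ * ann d)).trace = 0 :=
  trace_eq_zero_of_commutator h (comm_mul (comm_mul (number_comm_cre m a) (number_comm_ann m b))
    (comm_mul (number_comm_cre m c) (number_comm_ann m d)))

lemma trace_hopping_conjTranspose_mul_hopping {L : ℕ} [NeZero L] {k k' : Fin L} (hk : k ≠ 0)
    (hkk' : k ≠ k') : ((hopping k)ᴴ * hopping k').trace = 0 := by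
  unfold hopping
  rw [Matrix.conjTranspose_sum, Finset.sum_mul, Matrix.trace_sum]
  refine Finset.sum_eq_zero fun i _ => ?_
  rw [Finset.mul_sum, Matrix.trace_sum]
  refine Finset.sum_eq_zero fun j _ => ?_
  rw [Matrix.conjTranspose_mul, Matrix.conjTranspose_conjTranspose]
  have h1 : i + k ≠ i := by simpa using hk
  by_cases hij : j = i
  · subst hij
    -- In mode `j + k` only the first creation operator contributes: charge `1`.
    refine trace_cre_ann_cre_ann_eq_zero _ _ _ _ (j + k) ?_
    have h2 : j + k' ≠ j + k := by simpa using Ne.symm hkk'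
    simp [h1.symm, h2, -add_eq_left, -left_eq_add]
  -- Neither creation operator acts on mode `i` and at least one annihilation operator does: charge
  -- `-1` or `-2`.
  · refine trace_cre_ann_cre_ann_eq_zero _ _ _ _ i ?_
    simp only [if_neg h1, if_neg hij, if_true]
    split_ifs <;> norm_num

end FermionShadow

end

theorem mainTheorem3 (L : ℕ) [NeZero L] (hL : Odd L) :
    {A : FermionShadow.FockOp L | A ∈ FermionShadow.W₂ L ∧ FermionShadow.channel L A = 0} =
        (Submodule.span ℂ {A : FermionShadow.FockOp L |
          ∃ k : Fin L, k ≠ 0 ∧ A = FermionShadow.hopping k} : Set (FermionShadow.FockOp L)) ∧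
      ∀ k k' : Fin L, k ≠ 0 → k' ≠ 0 → k ≠ k' →
        ((FermionShadow.hopping k)ᴴ * FermionShadow.hopping k').trace = 0 := by
  refine ⟨?_, fun k k' hk _ hkk' =>
    FermionShadow.trace_hopping_conjTranspose_mul_hopping hk hkk'⟩
  ext A
  rw [Set.mem_ofPred_eq, SetLike.mem_coe, FermionShadow.mem_span_hopping_iff]
  constructor
  · rintro ⟨hA, h0⟩
    obtain ⟨x, rfl⟩ := FermionShadow.mem_W₂_iff.1 hA
    rw [FermionShadow.channel_eq_zero_iff_conjDiagZero] at h0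
    exact ⟨x, h0.shift (by rwa [Fintype.card_fin]), h0.diag, rfl⟩
  · rintro ⟨x, hx, hx0, rfl⟩
    exact ⟨FermionShadow.mem_W₂_iff.2 ⟨x, rfl⟩,
      (FermionShadow.channel_eq_zero_iff_conjDiagZero x).2
        (FermionShadow.conjDiagZero_of_shift hx hx0)⟩
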